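/- **Setting.** Let $X\in\mathbb R^{n\times p}$ ($p\ge1$) be a fixed matrix with columns $X_j$. For $v\in\mathbb R^n$ put $\|v\|_n^2:=v^Tv/n$, and assume $\|X_j\|_n=1$ for all $j$. Let $Y=X\beta^0+\epsilon$ with $\beta^0\in\mathbb R^p$ and $\epsilon\sim\mathcal N_n(0,\sigma_0^2I)$, $\sigma_0>0$. For a tuning parameter $\lambda_0$, the square-root Lasso $\hat\beta$ is any minimizer over $\beta\in\mathbb R^p$ of $\|Y-X\beta\|_n+\lambda_0\|\beta\|_1$, and $\hat\sigma:=\|Y-X\hat\beta\|_n$. Let $S_0:=\{j:\beta^0_j\ne0\}$, $s_0:=|S_0|$, and let $\hat\Lambda_{\max}^2(S_0)$ be the largest eigenvalue of $X_{S_0}^TX_{S_0}/n$, where $X_{S_0}$ is the submatrix of the columns $X_j$, $j\in S_0$ (with $\hat\Lambda_{\max}(\emptyset):=0$). For $L>0$ and nonempty $S\subset\{1,\dots,p\}$ the compatibility constant is $$\hat\phi^2(L,S):=\min\Bigl\{|S|\,\|X\beta\|_n^2:\ \textstyle\sum_{j\in S}|\beta_j|=1,\ \sum_{j\notin S}|\beta_j|\le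 L\Bigr\},$$ and $\hat\phi^2(L,\emptyset):=1$. **Lemma.** Let $\alpha_0,\underline\alpha>0$ with $\alpha_0+\underline\alpha<1$ and $\log(1/\underline\alpha)<n/4$. Define $$\underline\sigma^2:=\sigma_0^2\Bigl(1-2\sqrt{\tfrac{\log(1/\underline\alpha)}{n}}\Bigr)\ (\underline\sigma>0),\qquad R:=\sqrt{\frac{\log(2p/\alpha_0)}{n-2\sqrt{n\log(1/\underline\alpha)}}}.$$ Assume, for some $0<\eta\le1/3$, the $\ell_1$-sparsity condition $$R\|\beta^0\|_1/\underline\sigma\le(1-\eta)\bigl(\sqrt{1+(\eta/2)^2}-1\bigr),$$ and, for some $0<r<1$ and $\rho_r>0$, the $\ell_r$-sparsity condition $\sum_{j=1}^p|\beta^0_j|^r\le\rho_r^r$. Put $S_*:=\{j:|\beta_j^0|>3R\underline\sigma/\hat\Lambda_{\max}(S_0)\}$ (with $S_*:=\emptyset$ if $\beta^0=0$), and let $\lambda_0(1-\eta)=2R$. Then there is an event of probability at least $1-\alpha_0-\underline\alpha$ on which, for every minimizer $\hat\beta$, one has $\|\epsilon\|_n>0$, $\hat\sigma>0$, the $\ell_r$-based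 bound $$(1-\eta)\frac{\|\hat\beta-\beta^0\|_1}{\hat\sigma}\le\frac{\|\hat\beta-\beta^0\|_1}{\|\epsilon\|_n}\le(6R)^{1-r}\Bigl(1+\frac{6^2\hat\Lambda_{\max}^r(S_0)}{\hat\phi^2(6,S_*)}\Bigr)\Bigl(\frac{\rho_r}{\underline\sigma}\Bigr)^r,$$ the $\ell_0$-based bound $$(1-\eta)\frac{\|\hat\beta-\beta^0\|_1}{\hat\sigma}\le\frac{\|\hat\beta-\beta^0\|_1}{\|\epsilon\|_n}\le3R\,\frac{6^2s_0}{\hat\phi^2(6,S_0)},$$ and $$(1-\eta)\frac{\sigma_0}{\hat\sigma}\le\Bigl(1-2\sqrt{\tfrac{\log(1/\underline\alpha)}{n}}\Bigr)^{-1/2}.$$ The rightmost member of either of the first two displays is read as $+\infty$ when the compatibility constant in it is $0$. -/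

import Mathlib

open MeasureTheory ProbabilityTheory
open scoped Matrix

noncomputable section

namespace SqrtLasso

variable {n p : ℕ}

/-- The normalized Euclidean norm `‖v‖_n = √(vᵀ v / n)` on `ℝⁿ`. -/
def nNorm (v : Fin n → ℝ) : ℝ := Real.sqrt (v ⬝ᵥ v / n)

/-- The `ℓ₁`-norm on `ℝᵖ`. -/
def l1Norm (β : Fin p → ℝ) : ℝ := ∑ j, |β j|

/-- `b` is a square-root Lasso solution: it minimizes `‖Y - X β‖_n + lam ‖β‖₁` over `β ∈ ℝᵖ`. -/
def IsSqrtLasso (X : Matrix (Fin n) (Fin p) ℝ) (Y : Fin n → ℝ) (lam : ℝ) (b : Fin p → ℝ) : Prop :=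
  ∀ β : Fin p → ℝ,
    nNorm (Y - X *ᵥ b) + lam * l1Norm b ≤ nNorm (Y - X *ᵥ β) + lam * l1Norm β

/-- The active set `S_β = {j : β_j ≠ 0}`. -/
def activeSet (β : Fin p → ℝ) : Finset (Fin p) := Finset.univ.filter fun j => β j ≠ 0

/-- The Gram matrix `X_Sᵀ X_S / n` of the columns of `X` with index in `S`. -/
def gram (X : Matrix (Fin n) (Fin p) ℝ) (S : Finset (Fin p)) : Matrix S S ℝ :=
  (n : ℝ)⁻¹ •
    ((X.submatrix id (Subtype.val : S → Fin p))ᵀ * X.submatrix id (Subtype.val : S → Fin p))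

/-- `Λ_max(S)`, the square root of the largest eigenvalue of `X_Sᵀ X_S / n`
(with the value `0` for `S = ∅`). -/
def lambdaMax (X : Matrix (Fin n) (Fin p) ℝ) (S : Finset (Fin p)) : ℝ :=
  Real.sqrt (sSup (spectrum ℝ (gram X S)))

/-- The squared compatibility constant
`φ²(L,S) = min {|S| ‖X β‖_n² : ‖β_S‖₁ = 1, ‖β_{-S}‖₁ ≤ L}` for nonempty `S`.
For `S = ∅` no `β` is admissible; the value is then `1`, which is the upper bound of `φ²(L,S)`
over nonempty `S` for a design with normalized columns. -/
def compatSq (X : Matrix (Fin n) (Fin p) ℝ) (L : ℝ) (S : Finset (Fin p)) : ℝ :=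
  if S = ∅ then 1 else
    sInf {t : ℝ | ∃ β : Fin p → ℝ,
      ∑ j ∈ S, |β j| = 1 ∧ ∑ j ∈ Sᶜ, |β j| ≤ L ∧ t = S.card * nNorm (X *ᵥ β) ^ 2}

/-- The lower noise level `σ₀ (1 - 2 √(log (1/a) / n))^{1/2}`. -/
def sigmaLow (n : ℕ) (σ₀ a : ℝ) : ℝ :=
  σ₀ * Real.sqrt (1 - 2 * Real.sqrt (Real.log (1 / a) / n))

/-- `R = √(log (2p/α₀) / (n - 2 √(n log (1/a))))`. -/
def noiseR (n p : ℕ) (α₀ a : ℝ) : ℝ :=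
  Real.sqrt (Real.log (2 * p / α₀) / (n - 2 * Real.sqrt (n * Real.log (1 / a))))

/-- The set `S_* = {j : |β⁰_j| > 3 R σ / Λ_max(S₀)}` with `S₀` the active set of `β⁰`. -/
def sStar (X : Matrix (Fin n) (Fin p) ℝ) (β₀ : Fin p → ℝ) (R σ : ℝ) : Finset (Fin p) :=
  Finset.univ.filter fun j => 3 * R * σ / lambdaMax X (activeSet β₀) < |β₀ j|

end SqrtLasso

end

/-! Write N = ‖ε‖_n, σ̂ for the residual norm and K = R N. Differentiating the objective at a
minimizer and multiplying by σ̂ gives the basic inequality of an ordinary Lasso with penalty λ₀σ̂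
(`IsSqrtLasso.basic_inequality`). The ℓ₁-sparsity condition forces (1-η)N ≤ σ̂ ≤ (1+η)N
(`IsSqrtLasso.residual_bounds`), so this penalty lies in [2K, 4K], while the noise correlations are
at most √2 K.

`IsSqrtLasso.oracle_inequality` then splits on the cone with constant 6 around S. Inside it,
compatibility turns the quadratic term into a bound on the ℓ₁-error. Outside it, the coordinatewise
noise bound suffices when β⁰ vanishes off S; otherwise it leaves too little margin for the constant
37. There the noise is projected onto the span of the columns in S, at a cost √|S| ‖Xd‖_n that the
quadratic term absorbs. S = S₀ gives the ℓ₀-bound; S = S_* gives the ℓ_r-bound through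
`weak_sparsity_bound`.

The projection needs at most p functionals besides the p columns (`exists_projection_family`). Since
the two-sided Gaussian tail is exp(-t²/2) without a prefactor 2, each of these 2p functionals costs
only α₀/(2p). A chi-square lower tail spends the remaining budget on N ≥ σl. -/

namespace SqrtLasso

/-! ### Basic inequality, compatibility constant and Gram eigenvalues -/

section Deterministic

variable {n p : ℕ}

lemma nNorm_nonneg (v : Fin n → ℝ) : 0 ≤ nNorm v := Real.sqrt_nonneg _

lemma dotProduct_self_nonneg' (v : Fin n → ℝ) : 0 ≤ v ⬝ᵥ v :=
  Finset.sum_nonneg fun i _ => mul_self_nonneg (v i)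

lemma nNorm_sq (v : Fin n → ℝ) : nNorm v ^ 2 = v ⬝ᵥ v / n :=
  Real.sq_sqrt (div_nonneg (dotProduct_self_nonneg' v) n.cast_nonneg)

lemma dotProduct_div_le_nNorm_mul_nNorm (u v : Fin n → ℝ) :
    u ⬝ᵥ v / n ≤ nNorm u * nNorm v := by
  have h : (u ⬝ᵥ v) ^ 2 ≤ (u ⬝ᵥ u) * (v ⬝ᵥ v) := by
    have := Finset.sum_mul_sq_le_sq_mul_sq Finset.univ u v
    simpa [dotProduct, sq] using this
  refine abs_le_of_sq_le_sq' ?_ (mul_nonneg (nNorm_nonneg u) (nNorm_nonneg v)) |>.2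
  rw [mul_pow, nNorm_sq, nNorm_sq, div_pow, div_mul_div_comm, ← sq]
  gcongr

lemma l1Norm_nonneg (β : Fin p → ℝ) : 0 ≤ l1Norm β := Finset.sum_nonneg fun _ _ => abs_nonneg _

lemma l1Norm_eq_add_compl (S : Finset (Fin p)) (β : Fin p → ℝ) :
    l1Norm β = ∑ j ∈ S, |β j| + ∑ j ∈ Sᶜ, |β j| := (Finset.sum_add_sum_compl S _).symm

lemma l1Norm_sub_le (a b : Fin p → ℝ) : l1Norm (a - b) ≤ l1Norm a + l1Norm b := by
  rw [l1Norm, l1Norm, l1Norm, ← Finset.sum_add_distrib]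
  exact Finset.sum_le_sum fun j _ => abs_sub _ _

lemma l1Norm_convexComb_le (a b : Fin p → ℝ) {t : ℝ} (h0 : 0 ≤ t) (h1 : t ≤ 1) :
    l1Norm (a - t • (a - b)) ≤ (1 - t) * l1Norm a + t * l1Norm b := by
  rw [l1Norm, l1Norm, l1Norm, Finset.mul_sum, Finset.mul_sum, ← Finset.sum_add_distrib]
  refine Finset.sum_le_sum fun j _ => ?_
  have : (a - t • (a - b)) j = (1 - t) * a j + t * b j := by simp; ring
  rw [this]
  refine (abs_add_le _ _).trans ?_
  rw [abs_mul, abs_mul, abs_of_nonneg h0, abs_of_nonneg (sub_nonneg.2 h1)]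

/-- First-order lower bound for the `ℓ₁`-norm increment, split along an index set `S`. -/
lemma l1Norm_sub_l1Norm_ge (S : Finset (Fin p)) (b β : Fin p → ℝ) :
    ∑ j ∈ Sᶜ, |(b - β) j| - ∑ j ∈ S, |(b - β) j| - 2 * ∑ j ∈ Sᶜ, |β j| ≤
      l1Norm b - l1Norm β := by
  rw [l1Norm_eq_add_compl S b, l1Norm_eq_add_compl S β]
  have h1 : ∑ j ∈ S, |β j| ≤ ∑ j ∈ S, |b j| + ∑ j ∈ S, |(b - β) j| := by
    rw [← Finset.sum_add_distrib]
    refine Finset.sum_le_sum fun j _ => ?_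
    have := abs_sub (b j) ((b - β) j)
    simpa using this
  have h2 : ∑ j ∈ Sᶜ, |(b - β) j| ≤ ∑ j ∈ Sᶜ, |b j| + ∑ j ∈ Sᶜ, |β j| := by
    rw [← Finset.sum_add_distrib]
    exact Finset.sum_le_sum fun j _ => abs_sub _ _
  linarith

lemma dotProduct_mulVec_eq_sum (X : Matrix (Fin n) (Fin p) ℝ) (e : Fin n → ℝ) (d : Fin p → ℝ) :
    e ⬝ᵥ (X *ᵥ d) = ∑ j, d j * (e ⬝ᵥ fun i => X i j) := by
  simp only [dotProduct, Matrix.mulVec, Finset.mul_sum]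
  rw [Finset.sum_comm]
  exact Finset.sum_congr rfl fun j _ => Finset.sum_congr rfl fun i _ => by ring

lemma abs_dotProduct_mulVec_le (X : Matrix (Fin n) (Fin p) ℝ) (e : Fin n → ℝ) (d : Fin p → ℝ)
    {h : ℝ} (hh : ∀ j, |(e ⬝ᵥ fun i => X i j) / n| ≤ h) :
    e ⬝ᵥ (X *ᵥ d) / n ≤ h * l1Norm d := by
  rw [dotProduct_mulVec_eq_sum, Finset.sum_div, l1Norm, Finset.mul_sum]
  refine Finset.sum_le_sum fun j _ => ?_
  rw [mul_div_assoc, mul_comm h]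
  refine (le_abs_self _).trans ?_
  rw [abs_mul]
  exact mul_le_mul_of_nonneg_left (hh j) (abs_nonneg _)

/-- The basic inequality at a square-root Lasso solution with nonzero residual. -/
lemma IsSqrtLasso.basic_inequality {X : Matrix (Fin n) (Fin p) ℝ} {Y : Fin n → ℝ} {lam : ℝ}
    {b : Fin p → ℝ} (hb : IsSqrtLasso X Y lam b) (hlam : 0 ≤ lam) (hpos : 0 < nNorm (Y - X *ᵥ b))
    (β : Fin p → ℝ) :
    lam * nNorm (Y - X *ᵥ b) * (l1Norm b - l1Norm β) + nNorm (X *ᵥ (b - β)) ^ 2 ≤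
      (Y - X *ᵥ β) ⬝ᵥ (X *ᵥ (b - β)) / n := by
  set u := Y - X *ᵥ b with hu
  set w := X *ᵥ (b - β) with hw
  set s := nNorm u with hs
  have hYβ : Y - X *ᵥ β = u + w := by rw [hu, hw, Matrix.mulVec_sub]; abel
  -- Minimality is tested on the segment from b to β; convexity of the ℓ₁-norm makes the penalty
  -- change at most linear in t, and t → 0 removes the quadratic remainder.
  have key : ∀ t : ℝ, 0 < t → t ≤ 1 →
      lam * s * (l1Norm b - l1Norm β) ≤ u ⬝ᵥ w / n + t * (nNorm w ^ 2 / 2) := by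
    intro t ht0 ht1
    have h1 := hb (b - t • (b - β))
    have h2 := l1Norm_convexComb_le b β ht0.le ht1
    have h3 : Y - X *ᵥ (b - t • (b - β)) = u + t • w := by
      rw [hu, hw, Matrix.mulVec_sub X b, Matrix.mulVec_smul]; abel
    rw [h3, ← hu, ← hs] at h1
    have h4 : nNorm (u + t • w) ^ 2 = s ^ 2 + 2 * t * (u ⬝ᵥ w / n) + t ^ 2 * nNorm w ^ 2 := by
      rw [hs, nNorm_sq, nNorm_sq, nNorm_sq]
      simp only [add_dotProduct, dotProduct_add, smul_dotProduct, dotProduct_smul, smul_eq_mul,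
        dotProduct_comm w u]
      ring
    have h5 : lam * l1Norm (b - t • (b - β)) ≤ lam * ((1 - t) * l1Norm b + t * l1Norm β) :=
      mul_le_mul_of_nonneg_left h2 hlam
    have h6 : s + t * lam * (l1Norm b - l1Norm β) ≤ nNorm (u + t • w) := by nlinarith
    -- The factor 2s trades the norm for its square, which is an explicit polynomial in t.
    have h7 : 2 * s * (nNorm (u + t • w) - s) ≤ nNorm (u + t • w) ^ 2 - s ^ 2 := by
      nlinarith [sq_nonneg (nNorm (u + t • w) - s)]
    have h8 : 2 * s * (t * lam * (l1Norm b - l1Norm β)) ≤ 2 * s * (nNorm (u + t • w) - s) :=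
      mul_le_mul_of_nonneg_left (by linarith) (by linarith)
    have h9 : (2 * t) * (lam * s * (l1Norm b - l1Norm β)) ≤
        (2 * t) * (u ⬝ᵥ w / n + t * (nNorm w ^ 2 / 2)) := by
      rw [h4] at h7; linarith
    exact le_of_mul_le_mul_left h9 (by linarith)
  have lim : lam * s * (l1Norm b - l1Norm β) ≤ u ⬝ᵥ w / n := by
    refine le_of_forall_pos_le_add fun δ hδ => ?_
    have hq : 0 < nNorm w ^ 2 / 2 + 1 := by positivity
    have ht : 0 < min 1 (δ / (nNorm w ^ 2 / 2 + 1)) := lt_min one_pos (div_pos hδ hq)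
    refine (key _ ht (min_le_left _ _)).trans ?_
    gcongr
    calc min 1 (δ / (nNorm w ^ 2 / 2 + 1)) * (nNorm w ^ 2 / 2)
        ≤ (δ / (nNorm w ^ 2 / 2 + 1)) * (nNorm w ^ 2 / 2 + 1) := by
          gcongr
          · exact min_le_right _ _
          · linarith
      _ = δ := div_mul_cancel₀ _ hq.ne'
  rw [hYβ, add_dotProduct, add_div, ← nNorm_sq]
  linarith

/-- The compatibility constant controls the `ℓ₁`-norm on `S` over the cone with constant `L`. -/
lemma compatSq_mul_sq_le (X : Matrix (Fin n) (Fin p) ℝ) {L : ℝ} {S : Finset (Fin p)}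
    (hS : S.Nonempty) (d : Fin p → ℝ)
    (hd : ∑ j ∈ Sᶜ, |d j| ≤ L * ∑ j ∈ S, |d j|) :
    compatSq X L S * (∑ j ∈ S, |d j|) ^ 2 ≤ S.card * nNorm (X *ᵥ d) ^ 2 := by
  set a := ∑ j ∈ S, |d j| with ha
  have ha0 : 0 ≤ a := Finset.sum_nonneg fun _ _ => abs_nonneg _
  rcases ha0.eq_or_lt with h0 | hpos
  · rw [← h0, zero_pow two_ne_zero, mul_zero]; positivity
  have hmem : (S.card : ℝ) * nNorm (X *ᵥ (a⁻¹ • d)) ^ 2 ∈ {t : ℝ | ∃ β : Fin p → ℝ,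
      ∑ j ∈ S, |β j| = 1 ∧ ∑ j ∈ Sᶜ, |β j| ≤ L ∧ t = S.card * nNorm (X *ᵥ β) ^ 2} := by
    refine ⟨a⁻¹ • d, ?_, ?_, rfl⟩
    · simp only [Pi.smul_apply, smul_eq_mul, abs_mul, ← Finset.mul_sum, ← ha,
        abs_of_pos (inv_pos.2 hpos)]
      exact inv_mul_cancel₀ hpos.ne'
    · simp only [Pi.smul_apply, smul_eq_mul, abs_mul, ← Finset.mul_sum, abs_of_pos (inv_pos.2 hpos)]
      rw [inv_mul_le_iff₀ hpos]; linarith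
  have hle : compatSq X L S ≤ (S.card : ℝ) * nNorm (X *ᵥ (a⁻¹ • d)) ^ 2 := by
    rw [compatSq, if_neg hS.ne_empty]
    refine csInf_le ⟨0, ?_⟩ hmem
    rintro t ⟨β, -, -, rfl⟩
    positivity
  have hsc : nNorm (X *ᵥ (a⁻¹ • d)) ^ 2 = a⁻¹ ^ 2 * nNorm (X *ᵥ d) ^ 2 := by
    rw [nNorm_sq, nNorm_sq, Matrix.mulVec_smul, smul_dotProduct, dotProduct_smul, smul_eq_mul,
      smul_eq_mul]
    ring
  calc compatSq X L S * a ^ 2 ≤ S.card * nNorm (X *ᵥ (a⁻¹ • d)) ^ 2 * a ^ 2 := by gcongr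
    _ = S.card * nNorm (X *ᵥ d) ^ 2 := by rw [hsc]; field_simp

/-- Signs can be chosen so that the squared norm of the signed sum is at most the sum of the
squared norms. -/
lemma exists_signs_nNorm_sq_le (X : Matrix (Fin n) (Fin p) ℝ)
    (hX : ∀ j, nNorm (fun i => X i j) = 1) (S : Finset (Fin p)) :
    ∃ β : Fin p → ℝ, (∀ j ∈ S, |β j| = 1) ∧ (∀ j ∉ S, β j = 0) ∧
      nNorm (X *ᵥ β) ^ 2 ≤ S.card := by
  induction S using Finset.induction_on with
  | empty => exact ⟨0, by simp, by simp, by simp [nNorm]⟩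
  | insert k S hk ih =>
    obtain ⟨β, h1, h2, h3⟩ := ih
    have hadd : ∀ c : ℝ, nNorm (X *ᵥ (β + Pi.single k c)) ^ 2 =
        nNorm (X *ᵥ β) ^ 2 + c * (2 * ((X *ᵥ β) ⬝ᵥ fun i => X i k) / n) + c ^ 2 := by
      intro c
      have hk1 : (fun i => X i k) ⬝ᵥ (fun i => X i k) / (n : ℝ) = 1 := by
        rw [← nNorm_sq, hX k, one_pow]
      have hs : X *ᵥ Pi.single k c = c • fun i => X i k := by
        ext i; simp [Matrix.mulVec_single, mul_comm]
      rw [nNorm_sq, nNorm_sq, Matrix.mulVec_add, hs]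
      simp only [add_dotProduct, dotProduct_add, smul_dotProduct, dotProduct_smul, smul_eq_mul,
        dotProduct_comm (fun i => X i k) (X *ᵥ β)]
      linear_combination c ^ 2 * hk1
    -- The new sign is chosen against the cross term, so the squared norm grows by at most one.
    have hc : ∃ c : ℝ, |c| = 1 ∧ c * (2 * ((X *ᵥ β) ⬝ᵥ fun i => X i k) / n) ≤ 0 := by
      rcases le_total 0 (2 * ((X *ᵥ β) ⬝ᵥ fun i => X i k) / n) with h | h
      · exact ⟨-1, by simp, by linarith⟩
      · exact ⟨1, by simp, by linarith⟩
    obtain ⟨c, hc1, hc2⟩ := hc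
    refine ⟨β + Pi.single k c, ?_, ?_, ?_⟩
    · intro j hj
      rcases Finset.mem_insert.1 hj with rfl | hj
      · simp [h2 j hk, hc1]
      · have : j ≠ k := fun h => hk (h ▸ hj)
        simp [this, h1 j hj]
    · intro j hj
      rw [Finset.mem_insert, not_or] at hj
      simp [hj.1, h2 j hj.2]
    · rw [hadd, Finset.card_insert_of_notMem hk, ← sq_abs c, hc1]
      push_cast
      linarith

/-- A well-chosen sign vector supported on S is a test vector. The bound later gives |S| ≤ |S|/φ²
outside the cone and Λ^r/φ² ≥ 1 in the ℓ_r-bound. -/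
lemma compatSq_le_one (X : Matrix (Fin n) (Fin p) ℝ)
    (hX : ∀ j, nNorm (fun i => X i j) = 1) {L : ℝ} (hL : 0 ≤ L) (S : Finset (Fin p)) :
    compatSq X L S ≤ 1 := by
  rcases S.eq_empty_or_nonempty with rfl | hS
  · simp [compatSq]
  obtain ⟨β, h1, h2, h3⟩ := exists_signs_nNorm_sq_le X hX S
  have hcard : (0 : ℝ) < S.card := by exact_mod_cast hS.card_pos
  have hsum : ∑ j ∈ S, |β j| = S.card := by
    rw [Finset.sum_congr rfl h1]; simp
  have hsum' : ∑ j ∈ Sᶜ, |β j| = 0 :=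
    Finset.sum_eq_zero fun j hj => by rw [h2 j (Finset.mem_compl.1 hj), abs_zero]
  have := compatSq_mul_sq_le X (L := L) hS β (by rw [hsum', hsum]; positivity)
  rw [hsum] at this
  have h4 : (S.card : ℝ) * nNorm (X *ᵥ β) ^ 2 ≤ S.card * S.card := by gcongr
  have h5 : compatSq X L S * (S.card : ℝ) ^ 2 ≤ 1 * (S.card : ℝ) ^ 2 := by linarith
  exact le_of_mul_le_mul_right h5 (by positivity)

lemma isHermitian_gram (X : Matrix (Fin n) (Fin p) ℝ) (S : Finset (Fin p)) :
    (gram X S).IsHermitian := by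
  rw [Matrix.IsHermitian, gram, Matrix.conjTranspose_eq_transpose_of_trivial,
    Matrix.transpose_smul, Matrix.transpose_mul, Matrix.transpose_transpose]

lemma trace_gram (X : Matrix (Fin n) (Fin p) ℝ) (hX : ∀ j, nNorm (fun i => X i j) = 1)
    (S : Finset (Fin p)) : (gram X S).trace = S.card := by
  have h : ∀ j : S, gram X S j j = 1 := by
    intro j
    have h1 : (fun i => X i j) ⬝ᵥ (fun i => X i j) / (n : ℝ) = 1 := by
      rw [← nNorm_sq, hX j, one_pow]
    rw [← h1, gram, Matrix.smul_apply, Matrix.mul_apply, smul_eq_mul, div_eq_inv_mul]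
    rfl
  simp [Matrix.trace, h]

/-- With normalized columns the largest eigenvalue of a nonempty Gram matrix is at least one. -/
lemma one_le_lambdaMax (X : Matrix (Fin n) (Fin p) ℝ) (hX : ∀ j, nNorm (fun i => X i j) = 1)
    {S : Finset (Fin p)} (hS : S.Nonempty) : 1 ≤ lambdaMax X S := by
  have hH := isHermitian_gram X S
  have htr := hH.trace_eq_sum_eigenvalues
  rw [trace_gram X hX S] at htr
  have : Nonempty S := hS.to_subtype
  -- The trace is |S|, so the eigenvalues average to one.
  obtain ⟨i, -, hi⟩ : ∃ i ∈ (Finset.univ : Finset S), 1 ≤ hH.eigenvalues i := by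
    refine Finset.exists_le_of_sum_le Finset.univ_nonempty ?_
    simp only [Finset.sum_const, Finset.card_univ, Fintype.card_coe, nsmul_eq_mul, mul_one]
    exact htr.le
  rw [lambdaMax, Real.one_le_sqrt]
  exact hi.trans (le_csSup (Matrix.finite_spectrum _).bddAbove (hH.eigenvalues_mem_spectrum_real i))

end Deterministic

end SqrtLasso

namespace SqrtLasso

/-! ### Residual bounds, oracle inequality and weak sparsity -/

section Oracle

variable {n p : ℕ}

lemma sqrt_two_bounds : (1.4142 : ℝ) ≤ √2 ∧ √2 ≤ 1.41422 := by
  constructor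
  · exact Real.le_sqrt_of_sq_le (by norm_num)
  · exact Real.sqrt_le_iff.2 ⟨by norm_num, by norm_num⟩

lemma sqrt_one_add_sq_sub_one_le (η : ℝ) : √(1 + (η / 2) ^ 2) - 1 ≤ η ^ 2 / 8 := by
  have : √(1 + (η / 2) ^ 2) ≤ 1 + η ^ 2 / 8 :=
    Real.sqrt_le_iff.2 ⟨by positivity, by nlinarith [sq_nonneg (η ^ 2)]⟩
  linarith

/-- The residual norm of a square-root Lasso solution is close to the noise level. -/
lemma IsSqrtLasso.residual_bounds {X : Matrix (Fin n) (Fin p) ℝ} {β₀ b : Fin p → ℝ}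
    {ε : Fin n → ℝ} {lam R η : ℝ} (hb : IsSqrtLasso X (X *ᵥ β₀ + ε) lam b)
    (hη₀ : 0 < η) (hη₁ : η ≤ 1 / 3) (hR : 0 < R) (hlam : lam * (1 - η) = 2 * R)
    (hN : 0 < nNorm ε)
    (hl1 : R * l1Norm β₀ ≤ (1 - η) * (η ^ 2 / 8) * nNorm ε)
    (hnoise : ∀ j, |(ε ⬝ᵥ fun i => X i j) / n| ≤ √2 * R * nNorm ε) :
    (1 - η) * nNorm ε ≤ nNorm (X *ᵥ β₀ + ε - X *ᵥ b) ∧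
      nNorm (X *ᵥ β₀ + ε - X *ᵥ b) ≤ (1 + η) * nNorm ε := by
  obtain ⟨ht1, ht2⟩ := sqrt_two_bounds
  set t := √2
  set N := nNorm ε
  have hres : X *ᵥ β₀ + ε - X *ᵥ b = ε - X *ᵥ (b - β₀) := by rw [Matrix.mulVec_sub]; abel
  have hmin := hb β₀
  rw [add_sub_cancel_left] at hmin
  set s := nNorm (X *ᵥ β₀ + ε - X *ᵥ b) with hs
  have hB := l1Norm_nonneg b
  have hB0 := l1Norm_nonneg β₀
  have hlam2 : 2 * R ≤ lam := by nlinarith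
  have hlam3 : lam * l1Norm β₀ ≤ 2 * (η ^ 2 / 8) * N := by
    have h1 : 0 < 1 - η := by linarith
    refine le_of_mul_le_mul_right ?_ h1
    calc lam * l1Norm β₀ * (1 - η) = 2 * (R * l1Norm β₀) := by
          linear_combination l1Norm β₀ * hlam
      _ ≤ 2 * ((1 - η) * (η ^ 2 / 8) * N) := by linarith
      _ = _ := by ring
  -- Cauchy–Schwarz of ε against the residual, divided by N.
  have hlow : N - t * R * l1Norm (b - β₀) ≤ s := by
    have h1 := abs_dotProduct_mulVec_le X ε (b - β₀) hnoise
    have h2 := dotProduct_div_le_nNorm_mul_nNorm ε (ε - X *ᵥ (b - β₀))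
    rw [dotProduct_sub, sub_div, ← nNorm_sq, ← hres, ← hs] at h2
    change N ^ 2 - _ ≤ N * s at h2
    have h3 : N * (N - t * R * l1Norm (b - β₀)) ≤ N * s := by nlinarith
    exact le_of_mul_le_mul_left h3 hN
  have hΔ := l1Norm_sub_le b β₀
  have htR : t * R ≤ 1.41422 * R := by gcongr
  have htR0 : 0 ≤ t * R := by positivity
  have hlow' : N - t * R * (l1Norm b + l1Norm β₀) ≤ s :=
    le_trans (by gcongr) hlow
  -- Combining `hlow'` with minimality at β⁰; the 6 comes from (2+√2)/(2-√2) < 6, equivalently 7√2 <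
  -- 10.
  have hb6 : l1Norm b ≤ 6 * l1Norm β₀ := by
    have h1 : (lam - t * R) * l1Norm b ≤ (lam + t * R) * l1Norm β₀ := by linarith
    have h2 : 0 < lam - t * R := by linarith
    have h3 : lam + t * R ≤ (lam - t * R) * 6 := by linarith
    have h4 : (lam + t * R) * l1Norm β₀ ≤ (lam - t * R) * 6 * l1Norm β₀ := by gcongr
    refine le_of_mul_le_mul_left (h1.trans (h4.trans_eq (by ring))) h2
  constructor
  · have h1 : t * R * (l1Norm b + l1Norm β₀) ≤ 1.41422 * R * (7 * l1Norm β₀) := by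
      gcongr; linarith
    have h2 : R * l1Norm β₀ ≤ η / 10 * N := by
      refine hl1.trans ?_
      gcongr
      nlinarith
    nlinarith
  · have h1 : 0 ≤ lam * l1Norm b := mul_nonneg (by linarith) hB
    nlinarith [mul_pos hη₀ hN, mul_le_mul_of_nonneg_left hη₁ (mul_pos hη₀ hN).le]

/-- Oracle bound over the compatibility cone. -/
lemma oracle_bound_of_compat {K lam q a c m s φ : ℝ} (hK : 0 < K) (h1 : 2 * K ≤ lam)
    (h2 : lam ≤ 4 * K) (hm : 0 ≤ m) (hs : 0 ≤ s) (hφ : 0 < φ)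
    (hcomp : φ * a ^ 2 ≤ s * q ^ 2)
    (hbasic : q ^ 2 + (lam - √2 * K) * c ≤ (lam + √2 * K) * a + 2 * lam * m) :
    a + c ≤ 37 * m + 108 * K * (s / φ) := by
  obtain ⟨ht1, ht2⟩ := sqrt_two_bounds
  set t := √2
  have htK : t * K ≤ 1.41422 * K := by gcongr
  set w := s / φ with hw
  have hw0 : 0 ≤ w := by positivity
  have hcomp' : a ^ 2 ≤ w * q ^ 2 := by
    rw [hw, div_mul_eq_mul_div, le_div_iff₀ hφ]; linarith
  set D := lam - t * K with hD
  have hD0 : 0 < D := by linarith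
  -- AM–GM: (2λa)² ≤ 4(λ²w)q² ≤ (λ²w + q²)². The q² then cancels against the basic inequality.
  have h3 : 2 * lam * a ≤ lam ^ 2 * w + q ^ 2 := by
    refine (abs_le_of_sq_le_sq' ?_ (by positivity)).2
    have : (2 * lam * a) ^ 2 ≤ 4 * lam ^ 2 * (w * q ^ 2) := by
      calc (2 * lam * a) ^ 2 = 4 * lam ^ 2 * a ^ 2 := by ring
        _ ≤ _ := by gcongr
    nlinarith [sq_nonneg (lam ^ 2 * w - q ^ 2)]
  have h4 : D * (a + c) ≤ lam ^ 2 * w + 2 * lam * m := by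
    rw [hD] at *; linarith
  -- On 2K ≤ λ ≤ 4K both λ²/(DK) and 2λ/D stay below 7. The constants 108 = 3·36 and 37 = 1+36 are
  -- those of the final bounds, with slack.
  have h5 : lam ^ 2 ≤ D * (108 * K) := by nlinarith
  have h6 : 2 * lam ≤ D * 37 := by linarith
  have h7 : lam ^ 2 * w ≤ D * (108 * K) * w := by gcongr
  have h8 : 2 * lam * m ≤ D * 37 * m := by gcongr
  exact le_of_mul_le_mul_left (by linarith) hD0

/-- Oracle bound outside the compatibility cone, with the noise on `S` projected out. -/
lemma oracle_bound_of_not_cone {K lam q a c m s : ℝ} (hK : 0 < K) (h1 : 2 * K ≤ lam)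
    (hm : 0 ≤ m) (hs : 0 ≤ s) (ha : 0 ≤ a) (hcone : 6 * a ≤ c)
    (hbasic : q ^ 2 + lam * (c - a - 2 * m) ≤ √2 * K * (c + √s * q)) :
    a + c ≤ 37 * m + 108 * K * s := by
  obtain ⟨ht1, ht2⟩ := sqrt_two_bounds
  have ht : √2 ^ 2 = (2 : ℝ) := Real.sq_sqrt (by norm_num)
  have hss : √s ^ 2 = s := Real.sq_sqrt hs
  set t := √2
  have htK : t * K ≤ 1.41422 * K := by gcongr
  -- Completing the square absorbs the projected noise into q².
  have h2 : t * K * (√s * q) - q ^ 2 ≤ K ^ 2 * s / 2 := by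
    have h := sq_nonneg (q - t * K * √s / 2)
    have e : (q - t * K * √s / 2) ^ 2 = q ^ 2 - t * K * (√s * q) + t ^ 2 * K ^ 2 * √s ^ 2 / 4 := by
      ring
    rw [e, ht, hss] at h
    linarith
  have hc : 0 ≤ c := by linarith
  have h3 : lam * a ≤ lam * (c / 6) := by
    apply mul_le_mul_of_nonneg_left <;> linarith
  set D := 5 / 6 * lam - t * K with hD
  have h4 : D * c ≤ 2 * lam * m + K ^ 2 * s / 2 := by
    rw [hD] at *; linarith
  -- The cone condition replaces a by c/6, and (5/6)·2 - √2 > 1/4.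
  have hD1 : K / 4 ≤ D := by linarith
  have hD2 : 7 / 6 * (2 * lam) ≤ D * 37 := by linarith
  have hD0 : 0 < D := by linarith
  have h5 : 7 / 6 * (2 * lam) * m ≤ D * 37 * m := by gcongr
  have h6 : K / 4 * (108 * K * s) ≤ D * (108 * K * s) := by gcongr
  have h7 : 0 ≤ K ^ 2 * s := by positivity
  have h8 : D * (7 / 6 * c) ≤ D * (37 * m + 108 * K * s) := by linarith
  have h9 := le_of_mul_le_mul_left h8 hD0
  linarith

/-- Oracle inequality for the square-root Lasso, on the set where the noise is controlled. -/
lemma IsSqrtLasso.oracle_inequality {X : Matrix (Fin n) (Fin p) ℝ}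
    (hX : ∀ j, nNorm (fun i => X i j) = 1) {β₀ b : Fin p → ℝ}
    {ε : Fin n → ℝ} {lam K : ℝ} (hb : IsSqrtLasso X (X *ᵥ β₀ + ε) lam b) (hlam : 0 ≤ lam)
    (hK : 0 < K) (hpos : 0 < nNorm (X *ᵥ β₀ + ε - X *ᵥ b))
    (h1 : 2 * K ≤ lam * nNorm (X *ᵥ β₀ + ε - X *ᵥ b))
    (h2 : lam * nNorm (X *ᵥ β₀ + ε - X *ᵥ b) ≤ 4 * K)
    (hnoise : ∀ j, |(ε ⬝ᵥ fun i => X i j) / n| ≤ √2 * K)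
    (S : Finset (Fin p))
    (hproj : ∑ j ∈ Sᶜ, |β₀ j| = 0 ∨ ∀ d : Fin p → ℝ, ε ⬝ᵥ (X *ᵥ d) / n ≤
      √2 * K * (∑ j ∈ Sᶜ, |d j| + √S.card * nNorm (X *ᵥ d)))
    (hφ : 0 < compatSq X 6 S) :
    l1Norm (b - β₀) ≤ 37 * ∑ j ∈ Sᶜ, |β₀ j| + 108 * K * (S.card / compatSq X 6 S) := by
  obtain ⟨ht1, ht2⟩ := sqrt_two_bounds
  have htK : √2 * K ≤ 1.41422 * K := by gcongr
  have hbasic := hb.basic_inequality hlam hpos β₀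
  rw [add_sub_cancel_left] at hbasic
  have hsplit := l1Norm_sub_l1Norm_ge S b β₀
  have hn := abs_dotProduct_mulVec_le X ε (b - β₀) hnoise
  have hφ1 := compatSq_le_one X hX (L := 6) (by norm_num) S
  rw [l1Norm_eq_add_compl S (b - β₀)] at hn ⊢
  have hcomp := compatSq_mul_sq_le X (L := 6) (S := S)
  set lam' := lam * nNorm (X *ᵥ β₀ + ε - X *ᵥ b)
  have hlam' : 0 < lam' := by linarith
  set q := nNorm (X *ᵥ (b - β₀))
  set a := ∑ j ∈ S, |(b - β₀) j|
  set c := ∑ j ∈ Sᶜ, |(b - β₀) j|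
  set m := ∑ j ∈ Sᶜ, |β₀ j|
  set φ := compatSq X 6 S
  have ha : 0 ≤ a := Finset.sum_nonneg fun _ _ => abs_nonneg _
  have hc : 0 ≤ c := Finset.sum_nonneg fun _ _ => abs_nonneg _
  have hm : 0 ≤ m := Finset.sum_nonneg fun _ _ => abs_nonneg _
  have hinc : lam' * (c - a - 2 * m) ≤ lam' * (l1Norm b - l1Norm β₀) := by gcongr
  have hfull : q ^ 2 + (lam' - √2 * K) * c ≤ (lam' + √2 * K) * a + 2 * lam' * m := by linarith
  rcases le_or_gt c (6 * a) with hcone | hcone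
  · refine oracle_bound_of_compat hK h1 h2 hm S.card.cast_nonneg hφ ?_ hfull
    rcases S.eq_empty_or_nonempty with hS | hS
    · have : a = 0 := by simp only [a, hS, Finset.sum_empty]
      rw [this, zero_pow two_ne_zero, mul_zero]; positivity
    · exact hcomp hS (b - β₀) hcone
  -- With no approximation error the coordinatewise bound already rules out c > 6a, because 5·2K >
  -- 7√2 K; otherwise the projected noise bound is used.
  · rcases hproj with hm0 | hproj
    · change m = 0 at hm0
      have h3 : (lam' - √2 * K) * c ≤ (lam' + √2 * K) * a := by
        rw [hm0] at hfull; nlinarith [sq_nonneg q]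
      have h4 : (lam' - √2 * K) * (6 * a) < (lam' - √2 * K) * c := by
        apply mul_lt_mul_of_pos_left hcone; linarith
      have h5 : 0 ≤ (5 * lam' - 7 * (√2 * K)) * a := mul_nonneg (by linarith) ha
      linarith
    · have h3 := oracle_bound_of_not_cone (q := q) (s := S.card) hK h1 hm S.card.cast_nonneg ha
        hcone.le (by have := hproj (b - β₀); linarith)
      refine h3.trans ?_
      gcongr
      exact le_div_self S.card.cast_nonneg hφ hφ1

/-- The `ℓ_r`-ball dominates the approximation error and the size of the thresholded set. -/
lemma weak_sparsity_bound {X : Matrix (Fin n) (Fin p) ℝ}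
    (hX : ∀ j, nNorm (fun i => X i j) = 1) {β₀ : Fin p → ℝ} {R σ r ρ : ℝ} (hR : 0 < R)
    (hσ : 0 < σ) (hr₀ : 0 < r) (hr₁ : r < 1) (hρ : 0 < ρ) (hlr : ∑ j, |β₀ j| ^ r ≤ ρ ^ r)
    (hφ : 0 < compatSq X 6 (sStar X β₀ R σ)) :
    37 * (∑ j ∈ (sStar X β₀ R σ)ᶜ, |β₀ j|) / σ +
      108 * R * ((sStar X β₀ R σ).card / compatSq X 6 (sStar X β₀ R σ)) ≤
    (6 * R) ^ (1 - r) * (1 + 6 ^ 2 * lambdaMax X (activeSet β₀) ^ r /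
      compatSq X 6 (sStar X β₀ R σ)) * (ρ / σ) ^ r := by
  have hφ1 := compatSq_le_one X hX (L := 6) (by norm_num) (sStar X β₀ R σ)
  set S := sStar X β₀ R σ with hS
  set φ := compatSq X 6 S
  rcases (activeSet β₀).eq_empty_or_nonempty with h0 | hne
  · have hz : ∀ j, β₀ j = 0 := by
      intro j
      by_contra h
      have : j ∈ activeSet β₀ := by simp [activeSet, h]
      simp [h0] at this
    have hL : 0 ≤ lambdaMax X (activeSet β₀) := Real.sqrt_nonneg _
    -- For β⁰ = 0 no coordinate exceeds a nonnegative threshold; this also covers division by Λ = 0,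
    -- which yields threshold 0.
    have hSe : S = ∅ := by
      rw [hS, sStar, Finset.filter_eq_empty_iff]
      intro j _
      rw [hz j, abs_zero, not_lt]
      positivity
    simp only [hz, abs_zero, Finset.sum_const_zero, hSe, Finset.card_empty]
    simp only [mul_zero, zero_div, CharP.cast_eq_zero, add_zero]
    positivity
  have hL1 := one_le_lambdaMax X hX hne
  set Λ := lambdaMax X (activeSet β₀) with hΛ
  have hL0 : 0 < Λ := by linarith
  set PS := ∑ j ∈ S, |β₀ j| ^ r
  set PC := ∑ j ∈ Sᶜ, |β₀ j| ^ r
  have hPC : 0 ≤ PC := Finset.sum_nonneg fun _ _ => by positivity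
  have hP : PS + PC ≤ ρ ^ r := by rw [Finset.sum_add_sum_compl]; exact hlr
  have hτ : 3 * R * σ / Λ ≤ 6 * R * σ := by
    rw [div_le_iff₀ hL0]
    have : 0 < R * σ := by positivity
    nlinarith
  -- Below the threshold, |β| = |β|^(1-r) |β|^r with the first factor bounded.
  have hm : ∑ j ∈ Sᶜ, |β₀ j| ≤ (6 * R * σ) ^ (1 - r) * PC := by
    rw [Finset.mul_sum]
    refine Finset.sum_le_sum fun j hj => ?_
    have hj' : |β₀ j| ≤ 6 * R * σ := by
      have : ¬ 3 * R * σ / Λ < |β₀ j| := by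
        simpa [hS, sStar] using hj
      linarith
    rcases (abs_nonneg (β₀ j)).eq_or_lt with h | h
    · rw [← h]; positivity
    · calc |β₀ j| = |β₀ j| ^ (1 - r) * |β₀ j| ^ r := by
            rw [← Real.rpow_add h, sub_add_cancel, Real.rpow_one]
        _ ≤ _ := by gcongr
  -- Markov's inequality for counting measure bounds the number of large coordinates.
  have hc : (S.card : ℝ) * (3 * R * σ / Λ) ^ r ≤ PS := by
    rw [← nsmul_eq_mul]
    refine Finset.card_nsmul_le_sum _ _ _ fun j hj => ?_
    have : 3 * R * σ / Λ < |β₀ j| := by simpa [hS, sStar] using hj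
    gcongr
  have hT : (6 * R) ^ (1 - r) * (ρ / σ) ^ r = (6 * R * σ) ^ (1 - r) * ρ ^ r / σ := by
    rw [Real.div_rpow hρ.le hσ.le, Real.mul_rpow (by positivity) hσ.le, Real.rpow_sub hσ,
      Real.rpow_one]
    field_simp
  set A := (6 * R * σ) ^ (1 - r)
  have hA : 0 < A := by positivity
  set W := Λ ^ r / φ with hW
  have hW1 : 1 ≤ W := by
    rw [hW, one_le_div hφ]
    exact hφ1.trans (Real.one_le_rpow hL1 hr₀.le)
  have hAR : 3 * R * σ * (S.card / φ) ≤ A * W * PS := by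
    have h1 : (3 * R * σ) = (3 * R * σ) ^ (1 - r) * (3 * R * σ) ^ r := by
      rw [← Real.rpow_add (by positivity), sub_add_cancel, Real.rpow_one]
    have h2 : (3 * R * σ) ^ (1 - r) ≤ A := by
      apply Real.rpow_le_rpow (by positivity) _ (by linarith)
      have : 0 < R * σ := by positivity
      linarith
    have h3 : (3 * R * σ) ^ r = (3 * R * σ / Λ) ^ r * Λ ^ r := by
      rw [← Real.mul_rpow (by positivity) hL0.le, div_mul_cancel₀ _ hL0.ne']
    calc 3 * R * σ * (S.card / φ)
        = (3 * R * σ) ^ (1 - r) * W * (S.card * (3 * R * σ / Λ) ^ r) := by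
          rw [hW]
          nth_rewrite 1 [h1]
          rw [h3]
          ring
      _ ≤ A * W * PS := by clear h1 h3; gcongr
  have hPS : 0 ≤ PS := le_trans (by positivity) hc
  calc 37 * (∑ j ∈ Sᶜ, |β₀ j|) / σ + 108 * R * (S.card / φ)
      = (37 * (∑ j ∈ Sᶜ, |β₀ j|) + 36 * (3 * R * σ * (S.card / φ))) / σ := by
        field_simp
        ring
    _ ≤ (A * (1 + 36 * W) * ρ ^ r) / σ := by
        gcongr
        -- Here W ≥ 1 lets both parts of the r-sum share the factor 1 + 36W.
        have h1 : 37 * (A * PC) ≤ A * (1 + 36 * W) * PC := by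
          have : 0 ≤ A * PC := by positivity
          nlinarith
        have h2 : A * (1 + 36 * W) * (PS + PC) ≤ A * (1 + 36 * W) * ρ ^ r := by gcongr
        have h3 : 0 ≤ A * PS := by positivity
        linarith
    _ = (6 * R) ^ (1 - r) * (ρ / σ) ^ r * (1 + 36 * W) := by rw [hT]; ring
    _ = _ := by rw [hW]; ring

end Oracle

end SqrtLasso

namespace SqrtLasso

/-! ### Gaussian and chi-square tails -/

section Gaussian

open Real
open scoped NNReal ENNReal

/-- After a shift by t, (x+t)² ≥ x² + t² for x > 0 compares the densities pointwise. Keeping the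
half-line mass on the right avoids a factor 2 in the two-sided bound. -/
lemma gaussianReal_Ioi_le (v : ℝ≥0) {t : ℝ} (ht : 0 < t) :
    gaussianReal 0 v (Set.Ioi t) ≤
      ENNReal.ofReal (exp (-t ^ 2 / (2 * v))) * gaussianReal 0 v (Set.Ioi 0) := by
  by_cases hv : v = 0
  · subst hv
    simp [gaussianReal_zero_var, ht.le]
  have hshift : gaussianReal 0 v (Set.Ioi t) = gaussianReal (-t) v (Set.Ioi 0) := by
    rw [← zero_sub t, ← gaussianReal_map_sub_const, Measure.map_apply (by fun_prop)
      measurableSet_Ioi]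
    congr 1
    ext x
    simp
  rw [hshift, gaussianReal_apply _ hv, gaussianReal_apply _ hv,
    ← lintegral_const_mul _ (measurable_gaussianPDF 0 v)]
  refine setLIntegral_mono' measurableSet_Ioi fun x hx => ?_
  rw [gaussianPDF, gaussianPDF, ← ENNReal.ofReal_mul (exp_nonneg _)]
  refine ENNReal.ofReal_le_ofReal ?_
  rw [gaussianPDFReal, gaussianPDFReal, mul_left_comm, ← exp_add]
  have hvpos : (0 : ℝ) < v := by exact_mod_cast pos_iff_ne_zero.2 hv
  have hx0 : 0 < x := hx
  gcongr
  rw [← add_div]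
  gcongr
  nlinarith

/-- Sharp two-sided Gaussian tail bound. -/
lemma gaussianReal_abs_gt_le {v : ℝ≥0} {s t : ℝ} (hv : v ≤ s) (ht : 0 < t) :
    gaussianReal 0 v {x | t < |x|} ≤ ENNReal.ofReal (exp (-t ^ 2 / (2 * s))) := by
  by_cases hv0 : v = 0
  · subst hv0
    have hmeas : MeasurableSet {x : ℝ | t < |x|} := measurableSet_lt (by fun_prop) (by fun_prop)
    rw [gaussianReal_zero_var, Measure.dirac_apply' _ hmeas]
    simp [ht.le]
  have hvpos : (0 : ℝ) < v := by exact_mod_cast pos_iff_ne_zero.2 hv0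
  have hneg : ∀ a : ℝ, gaussianReal 0 v (Set.Iio (-a)) = gaussianReal 0 v (Set.Ioi a) := by
    intro a
    have := congrArg (fun m => m (Set.Ioi a)) (gaussianReal_map_neg (μ := 0) (v := v))
    simp only [neg_zero] at this
    rw [← this, Measure.map_apply (by fun_prop) measurableSet_Ioi]
    congr 1
    ext x
    simp
  have hset : {x : ℝ | t < |x|} = Set.Iio (-t) ∪ Set.Ioi t := by
    ext x
    simp only [Set.mem_ofPred_eq, Set.mem_union, Set.mem_Iio, Set.mem_Ioi, lt_abs]
    rw [or_comm, lt_neg]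
  have hhalf : gaussianReal 0 v (Set.Ioi 0) + gaussianReal 0 v (Set.Ioi 0) ≤ 1 := by
    nth_rewrite 1 [← hneg 0]
    rw [neg_zero, ← measure_union (by
      rw [Set.disjoint_left]; intro x h1 h2; exact lt_asymm (Set.mem_Iio.1 h1) (Set.mem_Ioi.1 h2)) measurableSet_Ioi]
    exact prob_le_one
  calc gaussianReal 0 v {x | t < |x|}
      ≤ gaussianReal 0 v (Set.Ioi t) + gaussianReal 0 v (Set.Ioi t) := by
        rw [hset]
        refine (measure_union_le _ _).trans ?_
        rw [hneg]
    _ ≤ ENNReal.ofReal (exp (-t ^ 2 / (2 * v))) *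
          (gaussianReal 0 v (Set.Ioi 0) + gaussianReal 0 v (Set.Ioi 0)) := by
        rw [mul_add]
        exact add_le_add (gaussianReal_Ioi_le v ht) (gaussianReal_Ioi_le v ht)
    _ ≤ ENNReal.ofReal (exp (-t ^ 2 / (2 * v))) := mul_le_of_le_one_right' hhalf
    _ ≤ _ := by
        refine ENNReal.ofReal_le_ofReal (exp_le_exp.2 ?_)
        rw [neg_div, neg_div, neg_le_neg_iff]
        gcongr

/-- A linear functional of a vector of independent centered Gaussians is Gaussian. -/
lemma hasLaw_dotProduct_pi_gaussianReal {ι : Type*} [Fintype ι] (v : ℝ≥0) (c : ι → ℝ) :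
    HasLaw (fun e : ι → ℝ => e ⬝ᵥ c) (gaussianReal 0 (v * ∑ i, ‖c i‖₊ ^ 2))
      (Measure.pi fun _ : ι => gaussianReal 0 v) := by
  classical
  set μ := Measure.pi fun _ : ι => gaussianReal 0 v
  have hind : iIndepFun (fun i (e : ι → ℝ) => e i * c i) μ :=
    iIndepFun_pi (X := fun i (x : ℝ) => x * c i) fun i => by fun_prop
  have hone : ∀ i, μ.map (fun e : ι → ℝ => e i * c i) = gaussianReal 0 (v * ‖c i‖₊ ^ 2) := by
    intro i
    have h1 : μ.map (fun e : ι → ℝ => e i) = gaussianReal 0 v :=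
      (measurePreserving_eval (fun _ : ι => gaussianReal 0 v) i).map_eq
    have h2 : (fun e : ι → ℝ => e i * c i) = (fun x => x * c i) ∘ fun e : ι → ℝ => e i := rfl
    rw [h2, ← Measure.map_map (by fun_prop) (by fun_prop), h1, gaussianReal_map_mul_const]
    congr 1
    · simp
    · ext; simp [mul_comm]
  have hsum : ∀ S : Finset ι, μ.map (∑ i ∈ S, fun e : ι → ℝ => e i * c i) =
      gaussianReal 0 (v * ∑ i ∈ S, ‖c i‖₊ ^ 2) := by
    intro S
    induction S using Finset.induction_on with
    | empty =>
      simp only [Finset.sum_empty, mul_zero, gaussianReal_zero_var]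
      change μ.map (fun _ => (0 : ℝ)) = _
      rw [Measure.map_const]; simp
    | insert k S hk ih =>
      rw [Finset.sum_insert hk, Finset.sum_insert hk]
      have hi := (hind.indepFun_finsetSum_of_notMem (fun i => by fun_prop) hk).symm
      rw [gaussianReal_add_gaussianReal_of_indepFun hi (hone k) ih, add_zero, mul_add]
  have hmeas : Measurable fun e : ι → ℝ => e ⬝ᵥ c := by simp only [dotProduct]; fun_prop
  refine ⟨hmeas.aemeasurable, ?_⟩
  rw [← hsum Finset.univ]
  congr 1
  ext e
  simp [dotProduct]

/-- The transform equals (1+2w)^(-1/2), and log(1+2w) ≥ 4w/(2w+2) ≥ 2w - 2w². -/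
lemma mgf_sq_gaussianReal_le {v : ℝ≥0} (hv : v ≠ 0) {w : ℝ} (hw : 0 ≤ w) :
    mgf (fun x => x ^ 2) (gaussianReal 0 v) (-(w / v)) ≤ exp (-w + w ^ 2) := by
  have hvpos : (0 : ℝ) < v := by exact_mod_cast pos_iff_ne_zero.2 hv
  have h1 : mgf (fun x => x ^ 2) (gaussianReal 0 v) (-(w / v)) = √(1 / (1 + 2 * w)) := by
    rw [mgf, integral_gaussianReal_eq_integral_smul hv]
    have : ∀ x : ℝ, gaussianPDFReal 0 v x • exp (-(w / v) * x ^ 2) =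
        (√(2 * π * v))⁻¹ * exp (-((1 + 2 * w) / (2 * v)) * x ^ 2) := by
      intro x
      rw [gaussianPDFReal, smul_eq_mul, mul_assoc, ← exp_add]
      congr 2
      field_simp
      ring
    simp_rw [this]
    rw [integral_const_mul, integral_gaussian, ← sqrt_inv, ← sqrt_mul (by positivity)]
    congr 1
    field_simp
  rw [h1, ← exp_log (show (0 : ℝ) < √(1 / (1 + 2 * w)) by positivity)]
  refine exp_le_exp.2 ?_
  rw [log_sqrt (by positivity), one_div, log_inv]
  have h2 := le_log_one_add_of_nonneg (x := 2 * w) (by positivity)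
  have h3 : 2 * w - 2 * w ^ 2 ≤ 2 * (2 * w) / (2 * w + 2) := by
    rw [le_div_iff₀ (by positivity)]
    nlinarith [pow_nonneg hw 3]
  linarith

/-- Lower tail bound for the chi-square distribution. -/
lemma pi_gaussianReal_sum_sq_le {n : ℕ} {v : ℝ≥0} (hv : v ≠ 0) {w : ℝ}
    (hw : 0 ≤ w) :
    (Measure.pi fun _ : Fin n => gaussianReal 0 v) {e | ∑ i, e i ^ 2 ≤ n * v * (1 - 2 * w)} ≤
      ENNReal.ofReal (exp (-(n * w ^ 2))) := by
  set μ := Measure.pi fun _ : Fin n => gaussianReal 0 v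
  have hvpos : (0 : ℝ) < v := by exact_mod_cast pos_iff_ne_zero.2 hv
  have hind : iIndepFun (fun i (e : Fin n → ℝ) => e i ^ 2) μ :=
    iIndepFun_pi (X := fun _ (x : ℝ) => x ^ 2) fun i => by fun_prop
  have ht : -(w / v) ≤ 0 := by rw [neg_nonpos]; positivity
  have hmgf : mgf (∑ i, fun e : Fin n → ℝ => e i ^ 2) μ (-(w / v)) ≤ exp (n * (-w + w ^ 2)) := by
    rw [hind.mgf_sum (fun i => by fun_prop)]
    have hone : ∀ i, mgf (fun e : Fin n → ℝ => e i ^ 2) μ (-(w / v)) ≤ exp (-w + w ^ 2) := by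
      intro i
      have h1 : μ.map (fun e : Fin n → ℝ => e i) = gaussianReal 0 v :=
        (measurePreserving_eval (fun _ : Fin n => gaussianReal 0 v) i).map_eq
      have h2 := mgf_sq_gaussianReal_le hv hw
      rw [← h1, mgf_map (X := fun x : ℝ => x ^ 2) (measurable_pi_apply i).aemeasurable
        (by fun_prop)] at h2
      exact h2
    calc _ ≤ ∏ _i : Fin n, exp (-w + w ^ 2) :=
          Finset.prod_le_prod (fun _ _ => mgf_nonneg) fun i _ => hone i
      _ = _ := by simp [← exp_nat_mul]
  have hint : Integrable (fun e => exp (-(w / v) *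
      (∑ i, fun e : Fin n → ℝ => e i ^ 2) e)) μ := by
    refine Integrable.of_bound (C := 1) (by fun_prop) (Filter.Eventually.of_forall fun e => ?_)
    rw [norm_of_nonneg (exp_nonneg _), exp_le_one_iff, Finset.sum_apply]
    exact mul_nonpos_of_nonpos_of_nonneg ht (Finset.sum_nonneg fun _ _ => sq_nonneg _)
  have hch := measure_le_le_exp_mul_mgf (n * v * (1 - 2 * w)) ht hint
  rw [← ofReal_measureReal]
  refine ENNReal.ofReal_le_ofReal ?_
  have hset : {e : Fin n → ℝ | ∑ i, e i ^ 2 ≤ n * v * (1 - 2 * w)} =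
      {e | (∑ i, fun e : Fin n → ℝ => e i ^ 2) e ≤ n * v * (1 - 2 * w)} := by
    ext e; simp
  rw [hset]
  refine hch.trans ?_
  -- The Chernoff exponent is nw(1-2w) + n(-w+w²) = -nw².
  calc _ ≤ exp (- -(w / v) * (n * v * (1 - 2 * w))) * exp (n * (-w + w ^ 2)) := by gcongr
    _ = exp (-(n * w ^ 2)) := by
      rw [← exp_add]
      congr 1
      field_simp
      ring

end Gaussian

/-! ### Union bound and projection of the noise -/

section NoiseEvent

variable {n p : ℕ}

/-- Union bound for finitely many normalized linear functionals of Gaussian noise. -/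
lemma pi_gaussianReal_exists_abs_dotProduct_gt_le {ι : Type*} [Fintype ι] (V : ι → Fin n → ℝ)
    (hn : 0 < n) (hV : ∀ i, nNorm (V i) ≤ 1) {σ₀ x : ℝ} (hσ₀ : 0 < σ₀) (hx : 0 < x) :
    (Measure.pi fun _ : Fin n => gaussianReal 0 (Real.toNNReal (σ₀ ^ 2)))
        {e | ∃ i, √2 * (σ₀ * √(x / n)) < |e ⬝ᵥ V i / n|} ≤
      ENNReal.ofReal (Fintype.card ι * Real.exp (-x)) := by
  set μ := Measure.pi fun _ : Fin n => gaussianReal 0 (Real.toNNReal (σ₀ ^ 2))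
  have hn' : (0 : ℝ) < n := by exact_mod_cast hn
  have hone : ∀ i, μ {e | √2 * (σ₀ * √(x / n)) < |e ⬝ᵥ V i / n|} ≤
      ENNReal.ofReal (Real.exp (-x)) := by
    intro i
    have hlaw := hasLaw_dotProduct_pi_gaussianReal (Real.toNNReal (σ₀ ^ 2)) (V i)
    have hset : {e : Fin n → ℝ | √2 * (σ₀ * √(x / n)) < |e ⬝ᵥ V i / n|} =
        {e | n * (√2 * (σ₀ * √(x / n))) < |e ⬝ᵥ V i|} := by
      ext e
      simp only [Set.mem_ofPred_eq, abs_div, Nat.abs_cast]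
      rw [lt_div_iff₀ hn', mul_comm]
    rw [hset, hlaw.measure_eq (p := fun y => n * (√2 * (σ₀ * √(x / n))) < |y|)
      (measurableSet_lt (by fun_prop) (by fun_prop))]
    refine (gaussianReal_abs_gt_le (s := σ₀ ^ 2 * n) ?_ (by positivity)).trans ?_
    · push_cast
      rw [Real.coe_toNNReal _ (sq_nonneg σ₀)]
      gcongr
      have h1 : nNorm (V i) ^ 2 ≤ 1 := pow_le_one₀ (nNorm_nonneg _) (hV i)
      rw [nNorm_sq, div_le_one hn'] at h1
      simpa [dotProduct, sq] using h1
    · refine ENNReal.ofReal_le_ofReal (Real.exp_le_exp.2 (le_of_eq ?_))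
      rw [mul_pow, mul_pow, mul_pow, Real.sq_sqrt (by norm_num), Real.sq_sqrt (by positivity)]
      field_simp
  have hsub : {e : Fin n → ℝ | ∃ i, √2 * (σ₀ * √(x / n)) < |e ⬝ᵥ V i / n|} =
      ⋃ i, {e | √2 * (σ₀ * √(x / n)) < |e ⬝ᵥ V i / n|} := by
    ext; simp
  rw [hsub]
  calc _ ≤ ∑ i, μ {e | √2 * (σ₀ * √(x / n)) < |e ⬝ᵥ V i / n|} := measure_iUnion_fintype_le _ _
    _ ≤ ∑ _i : ι, ENNReal.ofReal (Real.exp (-x)) := Finset.sum_le_sum fun i _ => hone i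
    _ = _ := by
      rw [Finset.sum_const, Finset.card_univ, nsmul_eq_mul, ENNReal.ofReal_mul (by positivity)]
      simp

/-- At most `p` normalized vectors control the noise with the columns in `S` projected out. -/
lemma exists_projection_family (X : Matrix (Fin n) (Fin p) ℝ) (hn : 0 < n)
    (hX : ∀ j, nNorm (fun i => X i j) = 1) (S : Finset (Fin p)) :
    ∃ (k : ℕ) (V : Fin k → Fin n → ℝ), k ≤ p ∧ (∀ i, nNorm (V i) ≤ 1) ∧
      ∀ (e : Fin n → ℝ) (h : ℝ), (∀ i, |e ⬝ᵥ V i / n| ≤ h) → 0 ≤ h → ∀ d : Fin p → ℝ,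
        e ⬝ᵥ (X *ᵥ d) / n ≤ h * (∑ j ∈ Sᶜ, |d j| + √S.card * nNorm (X *ᵥ d)) := by
  classical
  have hn' : (0 : ℝ) < n := by exact_mod_cast hn
  have hsn : 0 < √(n : ℝ) := Real.sqrt_pos.2 hn'
  let col : Fin p → EuclideanSpace ℝ (Fin n) := fun j => WithLp.toLp 2 fun i => X i j
  have hdot : ∀ u w : EuclideanSpace ℝ (Fin n), inner ℝ u w = u.ofLp ⬝ᵥ w.ofLp := by
    intro u w
    rw [EuclideanSpace.inner_eq_star_dotProduct, star_trivial, dotProduct_comm]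
  have hnorm : ∀ u : EuclideanSpace ℝ (Fin n), nNorm u.ofLp = ‖u‖ / √n := by
    intro u
    rw [nNorm, ← hdot, real_inner_self_eq_norm_sq, Real.sqrt_div (sq_nonneg _),
      Real.sqrt_sq (norm_nonneg _)]
  let K : Submodule ℝ (EuclideanSpace ℝ (Fin n)) := Submodule.span ℝ (col '' S)
  let P := K.starProjection
  let B := stdOrthonormalBasis ℝ K
  have hfin : Module.finrank ℝ K ≤ S.card := by
    have : K = Submodule.span ℝ ((S.image col : Finset (EuclideanSpace ℝ (Fin n))) : Set (EuclideanSpace ℝ (Fin n))) := by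
      simp [K]
    rw [this]
    exact (finrank_span_finset_le_card _).trans Finset.card_image_le
  -- An orthonormal basis of the span of the columns in S, scaled by √n to unit `nNorm`, and the
  -- remaining columns with that span projected out: at most |S| + (p - |S|) vectors.
  let V : Fin (Module.finrank ℝ K) ⊕ {j // j ∈ Sᶜ} → Fin n → ℝ :=
    Sum.elim (fun i => (√n • (B i : EuclideanSpace ℝ (Fin n))).ofLp) (fun j => (col j - P (col j)).ofLp)
  have hV : ∀ i, nNorm (V i) ≤ 1 := by
    rintro (i | j)
    · have h1 : ‖(B i : EuclideanSpace ℝ (Fin n))‖ = 1 := B.orthonormal.1 i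
      simp only [V, Sum.elim_inl]
      rw [hnorm, norm_smul, h1, Real.norm_of_nonneg hsn.le, mul_one, div_self hsn.ne']
    · simp only [V, Sum.elim_inr]
      have h1 : ‖col j - P (col j)‖ ≤ ‖col j‖ := by
        have := K.starProjection_orthogonal_val (col j)
        rw [← this]
        exact Submodule.norm_starProjection_apply_le _ _
      rw [hnorm]
      calc _ ≤ ‖col j‖ / √n := by gcongr
        _ = nNorm (col j).ofLp := (hnorm _).symm
        _ = 1 := hX j
        _ ≤ 1 := le_rfl
  have hcard : Fintype.card (Fin (Module.finrank ℝ K) ⊕ {j // j ∈ Sᶜ}) ≤ p := by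
    rw [Fintype.card_sum, Fintype.card_fin, Fintype.card_coe, Finset.card_compl, Fintype.card_fin]
    have : S.card ≤ p := by simpa using S.card_le_univ
    omega
  refine ⟨_, V ∘ (Fintype.equivFin _).symm, hcard, fun i => hV _, ?_⟩
  intro e h hh h0 d
  have hh' : ∀ i, |e ⬝ᵥ V i / n| ≤ h := fun i => by
    simpa using hh (Fintype.equivFin _ i)
  let y : EuclideanSpace ℝ (Fin n) := WithLp.toLp 2 (X *ᵥ d)
  let e' : EuclideanSpace ℝ (Fin n) := WithLp.toLp 2 e
  have hy : y = ∑ j, d j • col j := by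
    ext i
    simp [y, Matrix.mulVec, dotProduct, col, mul_comm]
  have hPcol : ∀ j ∈ S, P (col j) = col j := fun j hj =>
    Submodule.starProjection_eq_self_iff.2 (Submodule.subset_span ⟨j, hj, rfl⟩)
  have hres : y - P y = ∑ j ∈ Sᶜ, d j • (col j - P (col j)) := by
    have h1 : y - P y = ∑ j, d j • (col j - P (col j)) := by
      rw [hy, map_sum, ← Finset.sum_sub_distrib]
      simp [smul_sub]
    rw [h1, ← Finset.sum_add_sum_compl S, Finset.sum_eq_zero, zero_add]
    intro j hj
    rw [hPcol j hj, sub_self, smul_zero]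
  have hPy : P y = ∑ i, inner ℝ (B i : EuclideanSpace ℝ (Fin n)) y • (B i : EuclideanSpace ℝ (Fin n)) := by
    have h1 := B.sum_repr' (K.orthogonalProjectionOnto y)
    have h2 := congrArg (Subtype.val) h1
    rw [Submodule.starProjection_apply, ← h2]
    simp
  have hsumsq : ∑ i, inner ℝ (B i : EuclideanSpace ℝ (Fin n)) y ^ 2 = ‖P y‖ ^ 2 := by
    have h1 := B.sum_sq_norm_inner_right (K.orthogonalProjectionOnto y)
    simp at h1
    simpa [P] using h1
  have hpart1 : inner ℝ e' (P y) / n ≤ h * (√S.card * nNorm (X *ᵥ d)) := by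
    have hb : ∀ i, |inner ℝ e' (B i : EuclideanSpace ℝ (Fin n)) / √n| ≤ h := by
      intro i
      have h1 := hh' (Sum.inl i)
      have h2 : e ⬝ᵥ V (Sum.inl i) / n = inner ℝ e' (B i : EuclideanSpace ℝ (Fin n)) / √n := by
        have : e ⬝ᵥ V (Sum.inl i) = √n * inner ℝ e' (B i : EuclideanSpace ℝ (Fin n)) := by
          rw [← inner_smul_right, hdot]; rfl
        rw [this]
        nth_rewrite 2 [← Real.mul_self_sqrt hn'.le]
        rw [mul_div_mul_left _ _ hsn.ne']
      rwa [h2] at h1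
    -- Cauchy–Schwarz over the basis coefficients is the source of √|S|.
    have hcs : ∑ i, |inner ℝ (B i : EuclideanSpace ℝ (Fin n)) y| ≤ √S.card * ‖y‖ := by
      refine (abs_le_of_sq_le_sq' ?_ (by positivity)).2
      calc (∑ i, |inner ℝ (B i : EuclideanSpace ℝ (Fin n)) y|) ^ 2
          ≤ (Finset.univ : Finset (Fin (Module.finrank ℝ K))).card *
              ∑ i, |inner ℝ (B i : EuclideanSpace ℝ (Fin n)) y| ^ 2 := sq_sum_le_card_mul_sum_sq
        _ = Module.finrank ℝ K * ‖P y‖ ^ 2 := by simp [hsumsq]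
        _ ≤ S.card * ‖y‖ ^ 2 := by
          have h1 : ‖P y‖ ≤ ‖y‖ := Submodule.norm_starProjection_apply_le _ _
          gcongr
        _ = (√S.card * ‖y‖) ^ 2 := by rw [mul_pow, Real.sq_sqrt (by positivity)]
    have hy' : nNorm (X *ᵥ d) = ‖y‖ / √n := hnorm y
    rw [hy', hPy, inner_sum]
    calc (∑ i, inner ℝ e' (inner ℝ (B i : EuclideanSpace ℝ (Fin n)) y • (B i : EuclideanSpace ℝ (Fin n)))) / n
        = (∑ i, inner ℝ (B i : EuclideanSpace ℝ (Fin n)) y * (inner ℝ e' (B i : EuclideanSpace ℝ (Fin n)) / √n)) / √n := by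
          simp only [inner_smul_right, ← mul_div_assoc]
          rw [← Finset.sum_div, div_div, Real.mul_self_sqrt hn'.le]
      _ ≤ (∑ i, |inner ℝ (B i : EuclideanSpace ℝ (Fin n)) y| * h) / √n := by
          refine div_le_div_of_nonneg_right (Finset.sum_le_sum fun i _ => ?_) hsn.le
          refine (le_abs_self _).trans ?_
          rw [abs_mul]
          exact mul_le_mul_of_nonneg_left (hb i) (abs_nonneg _)
      _ = h * (∑ i, |inner ℝ (B i : EuclideanSpace ℝ (Fin n)) y|) / √n := by rw [← Finset.sum_mul, mul_comm]
      _ ≤ h * (√S.card * ‖y‖) / √n := by gcongr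
      _ = _ := by ring
  have hpart2 : inner ℝ e' (y - P y) / n ≤ h * ∑ j ∈ Sᶜ, |d j| := by
    rw [hres, inner_sum, Finset.sum_div, Finset.mul_sum]
    refine Finset.sum_le_sum fun j hj => ?_
    have h1 := hh' (Sum.inr ⟨j, hj⟩)
    have h2 : e ⬝ᵥ V (Sum.inr ⟨j, hj⟩) = inner ℝ e' (col j - P (col j)) := by
      rw [hdot]; rfl
    rw [h2] at h1
    rw [inner_smul_right, mul_div_assoc, mul_comm h]
    refine (le_abs_self _).trans ?_
    rw [abs_mul]
    exact mul_le_mul_of_nonneg_left h1 (abs_nonneg _)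
  have hsplit : e ⬝ᵥ (X *ᵥ d) = inner ℝ e' (P y) + inner ℝ e' (y - P y) := by
    rw [← inner_add_right, add_sub_cancel, hdot]
  rw [hsplit, add_div, mul_add]
  linarith

end NoiseEvent

end SqrtLasso

namespace SqrtLasso

/-! ### Probability of the noise event and the main theorem -/

variable {n p : ℕ}

/-- The event on which finitely many linear functionals of the noise are small and the noise level
is not underestimated has probability at least `1 - α₀ - αl`. -/
lemma pi_gaussianReal_noise_event {ι : Type*} [Fintype ι] (V : ι → Fin n → ℝ)
    (hn : 0 < n) (hV : ∀ i, nNorm (V i) ≤ 1) {σ₀ x L : ℝ} (hσ₀ : 0 < σ₀) (hx : 0 < x) (hL : 0 ≤ L) :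
    MeasurableSet {e : Fin n → ℝ | σ₀ * √(1 - 2 * √(L / n)) ≤ nNorm e ∧
        ∀ i, |e ⬝ᵥ V i / n| ≤ √2 * (σ₀ * √(x / n))} ∧
      ENNReal.ofReal (1 - Fintype.card ι * Real.exp (-x) - Real.exp (-L)) ≤
      (Measure.pi fun _ : Fin n => gaussianReal 0 (Real.toNNReal (σ₀ ^ 2)))
        {e | σ₀ * √(1 - 2 * √(L / n)) ≤ nNorm e ∧
          ∀ i, |e ⬝ᵥ V i / n| ≤ √2 * (σ₀ * √(x / n))} := by
  set μ := Measure.pi fun _ : Fin n => gaussianReal 0 (Real.toNNReal (σ₀ ^ 2))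
  set G := {e : Fin n → ℝ | σ₀ * √(1 - 2 * √(L / n)) ≤ nNorm e ∧
          ∀ i, |e ⬝ᵥ V i / n| ≤ √2 * (σ₀ * √(x / n))}
  have hn' : (0 : ℝ) < n := by exact_mod_cast hn
  have hG : MeasurableSet G := by
    have h1 : Measurable fun e : Fin n → ℝ => nNorm e := by
      simp only [nNorm, dotProduct]; fun_prop
    have h2 : ∀ i, Measurable fun e : Fin n → ℝ => |e ⬝ᵥ V i / n| := by
      intro i; simp only [dotProduct]; fun_prop
    have h3 : G = {e | σ₀ * √(1 - 2 * √(L / n)) ≤ nNorm e} ∩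
        ⋂ i, {e | |e ⬝ᵥ V i / n| ≤ √2 * (σ₀ * √(x / n))} := by
      ext e; simp [G]
    rw [h3]
    exact (measurableSet_le measurable_const h1).inter
      (MeasurableSet.iInter fun i => measurableSet_le (h2 i) measurable_const)
  refine ⟨hG, ?_⟩
  have hv : Real.toNNReal (σ₀ ^ 2) ≠ 0 := by
    rw [Ne, Real.toNNReal_eq_zero, not_le]; positivity
  have hchi := pi_gaussianReal_sum_sq_le (n := n) hv (Real.sqrt_nonneg (L / n))
  have htail := pi_gaussianReal_exists_abs_dotProduct_gt_le V hn hV hσ₀ hx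
  rw [Real.sq_sqrt (by positivity), mul_div_cancel₀ _ hn'.ne',
    Real.coe_toNNReal _ (sq_nonneg σ₀)] at hchi
  have hsub : Gᶜ ⊆ {e | ∑ i, e i ^ 2 ≤ n * σ₀ ^ 2 * (1 - 2 * √(L / n))} ∪
      {e | ∃ i, √2 * (σ₀ * √(x / n)) < |e ⬝ᵥ V i / n|} := by
    intro e he
    by_contra hcon
    simp only [Set.mem_union, Set.mem_ofPred_eq, not_or, not_le, not_exists, not_lt] at hcon
    refine he ⟨?_, hcon.2⟩
    rw [nNorm]
    rcases le_total (1 - 2 * √(L / n)) 0 with h | h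
    · rw [Real.sqrt_eq_zero_of_nonpos h, mul_zero]; exact Real.sqrt_nonneg _
    · refine Real.le_sqrt_of_sq_le ?_
      rw [mul_pow, Real.sq_sqrt h, le_div_iff₀ hn']
      have h1 := hcon.1.le
      have h2 : e ⬝ᵥ e = ∑ i, e i ^ 2 := by simp [dotProduct, sq]
      rw [h2]; linarith
  have hc : μ Gᶜ ≤ ENNReal.ofReal (Fintype.card ι * Real.exp (-x) + Real.exp (-L)) := by
    rw [add_comm, ENNReal.ofReal_add (Real.exp_nonneg _) (by positivity)]
    exact (measure_mono hsub).trans ((measure_union_le _ _).trans (add_le_add hchi htail))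
  have h1 : μ G = 1 - μ Gᶜ := by
    rw [← prob_compl_eq_one_sub hG.compl, compl_compl]
  rw [h1, sub_sub, ENNReal.ofReal_sub _ (by positivity), ENNReal.ofReal_one]
  exact tsub_le_tsub_left hc 1

/-- Since n - 2√(nL) = n(1 - 2√(L/n)), the correction in R cancels that in σl, so √2 Rσl is exactly
the Gaussian threshold at noise level σ₀. -/
lemma noise_constants {σ₀ α₀ αl : ℝ} (hn : 0 < n) (hp : 0 < p) (hσ₀ : 0 < σ₀) (hα₀ : 0 < α₀)
    (hαl : 0 < αl) (hα : α₀ + αl < 1) (hlog : Real.log (1 / αl) < n / 4) :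
    0 < Real.log (1 / αl) ∧ 0 < Real.log (2 * p / α₀) ∧
      0 < 1 - 2 * √(Real.log (1 / αl) / n) ∧ 0 < sigmaLow n σ₀ αl ∧ 0 < noiseR n p α₀ αl ∧
      noiseR n p α₀ αl * sigmaLow n σ₀ αl = σ₀ * √(Real.log (2 * p / α₀) / n) := by
  have hn' : (0 : ℝ) < n := by exact_mod_cast hn
  have hp' : (1 : ℝ) ≤ p := by exact_mod_cast hp
  have hL : 0 < Real.log (1 / αl) := Real.log_pos (by rw [one_lt_div hαl]; linarith)
  have hx : 0 < Real.log (2 * p / α₀) := Real.log_pos (by rw [one_lt_div hα₀]; linarith)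
  rw [sigmaLow, noiseR]
  set L := Real.log (1 / αl)
  set x := Real.log (2 * p / α₀)
  have hw : 0 < 1 - 2 * √(L / n) := by
    have : √(L / n) < 1 / 2 := by
      rw [Real.sqrt_lt' (by norm_num), div_lt_iff₀ hn']; linarith
    linarith
  have hnL : (n : ℝ) - 2 * √(n * L) = n * (1 - 2 * √(L / n)) := by
    have : √(n * L) = n * √(L / n) := by
      have h : (n : ℝ) * L = n ^ 2 * (L / n) := by field_simp
      rw [h, Real.sqrt_mul (by positivity), Real.sqrt_sq hn'.le]
    rw [this]; ring
  rw [hnL]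
  refine ⟨hL, hx, hw, by positivity, by positivity, ?_⟩
  rw [← div_div, Real.sqrt_div (by positivity)]
  field_simp

end SqrtLasso

open SqrtLasso in
theorem mainTheorem4 {Ω : Type*} [MeasurableSpace Ω] (μ : Measure Ω) [IsProbabilityMeasure μ]
    (n p : ℕ) (hp : 0 < p)
    (X : Matrix (Fin n) (Fin p) ℝ) (hX : ∀ j, SqrtLasso.nNorm (fun i => X i j) = 1)
    (β₀ : Fin p → ℝ) (σ₀ : ℝ) (hσ₀ : 0 < σ₀)
    (ε Y : Ω → Fin n → ℝ) (hY : ∀ ω, Y ω = X *ᵥ β₀ + ε ω)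
    (hε : HasLaw ε (Measure.pi fun _ : Fin n => gaussianReal 0 (Real.toNNReal (σ₀ ^ 2))) μ)
    (α₀ αl : ℝ) (hα₀ : 0 < α₀) (hαl : 0 < αl) (hα : α₀ + αl < 1)
    (hlog : Real.log (1 / αl) < n / 4)
    (σl R : ℝ) (hσl : σl = SqrtLasso.sigmaLow n σ₀ αl) (hR : R = SqrtLasso.noiseR n p α₀ αl)
    (η : ℝ) (hη₀ : 0 < η) (hη₁ : η ≤ 1 / 3)
    (hl1 : R * SqrtLasso.l1Norm β₀ / σl ≤ (1 - η) * (Real.sqrt (1 + (η / 2) ^ 2) - 1))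
    (r ρ : ℝ) (hr₀ : 0 < r) (hr₁ : r < 1) (hρ : 0 < ρ)
    (hlr : ∑ j, |β₀ j| ^ r ≤ ρ ^ r)
    (lam₀ : ℝ) (hlam : lam₀ * (1 - η) = 2 * R) :
    ∃ E : Set Ω, MeasurableSet E ∧ ENNReal.ofReal (1 - α₀ - αl) ≤ μ E ∧
      ∀ ω ∈ E, ∀ b : Fin p → ℝ, SqrtLasso.IsSqrtLasso X (Y ω) lam₀ b →
        0 < SqrtLasso.nNorm (ε ω) ∧
        0 < SqrtLasso.nNorm (Y ω - X *ᵥ b) ∧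
        (1 - η) * (SqrtLasso.l1Norm (b - β₀) / SqrtLasso.nNorm (Y ω - X *ᵥ b)) ≤
          SqrtLasso.l1Norm (b - β₀) / SqrtLasso.nNorm (ε ω) ∧
        (0 < SqrtLasso.compatSq X 6 (SqrtLasso.sStar X β₀ R σl) →
          SqrtLasso.l1Norm (b - β₀) / SqrtLasso.nNorm (ε ω) ≤
            (6 * R) ^ (1 - r) *
              (1 + 6 ^ 2 * SqrtLasso.lambdaMax X (SqrtLasso.activeSet β₀) ^ r /
                SqrtLasso.compatSq X 6 (SqrtLasso.sStar X β₀ R σl)) *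
              (ρ / σl) ^ r) ∧
        (0 < SqrtLasso.compatSq X 6 (SqrtLasso.activeSet β₀) →
          SqrtLasso.l1Norm (b - β₀) / SqrtLasso.nNorm (ε ω) ≤
            3 * R * (6 ^ 2 * (SqrtLasso.activeSet β₀).card /
              SqrtLasso.compatSq X 6 (SqrtLasso.activeSet β₀))) ∧
        (1 - η) * σ₀ / SqrtLasso.nNorm (Y ω - X *ᵥ b) ≤
          (1 - 2 * Real.sqrt (Real.log (1 / αl) / n)) ^ (-(1 / 2) : ℝ) := by
  have hn : 0 < n := by
    rcases n.eq_zero_or_pos with rfl | h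
    · have := hX ⟨0, hp⟩
      simp [nNorm] at this
    · exact h
  obtain ⟨hL, hx, hw, hσpos, hRpos, hRσ⟩ := noise_constants hn hp hσ₀ hα₀ hαl hα hlog
  rw [← hσl] at hσpos hRσ
  rw [← hR] at hRpos hRσ
  have hσeq : σl = σ₀ * √(1 - 2 * √(Real.log (1 / αl) / n)) := hσl
  set L := Real.log (1 / αl)
  set x := Real.log (2 * p / α₀)
  obtain ⟨k, V, hk, hV, hproj⟩ := exists_projection_family X hn hX (sStar X β₀ R σl)
  let W : Fin p ⊕ Fin k → Fin n → ℝ := Sum.elim (fun j i => X i j) V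
  have hW : ∀ i, nNorm (W i) ≤ 1 := by
    rintro (j | i)
    · exact (hX j).le
    · exact hV i
  obtain ⟨hGm, hGp⟩ := pi_gaussianReal_noise_event W hn hW hσ₀ hx hL.le
  rw [← hσeq, ← hRσ] at hGm hGp
  set G := {e : Fin n → ℝ | σl ≤ nNorm e ∧ ∀ i, |e ⬝ᵥ W i / n| ≤ √2 * (R * σl)}
  have hexp : Fintype.card (Fin p ⊕ Fin k) * Real.exp (-x) + Real.exp (-L) ≤ α₀ + αl := by
    have hp' : (0 : ℝ) < p := by exact_mod_cast hp
    have h1 : Real.exp (-x) = α₀ / (2 * p) := by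
      rw [Real.exp_neg, Real.exp_log (by positivity), inv_div]
    have h2 : Real.exp (-L) = αl := by
      rw [Real.exp_neg, Real.exp_log (by positivity), one_div, inv_inv]
    have h3 : (Fintype.card (Fin p ⊕ Fin k) : ℝ) ≤ 2 * p := by
      rw [Fintype.card_sum, Fintype.card_fin, Fintype.card_fin]
      have : (k : ℝ) ≤ p := by exact_mod_cast hk
      push_cast
      linarith
    rw [h1, h2]
    gcongr
    calc _ ≤ 2 * (p : ℝ) * (α₀ / (2 * p)) := by gcongr
      _ = α₀ := by field_simp
  -- `HasLaw` gives only a.e.-measurability of ε, so E is a measurable subset of the preimage with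
  -- the same measure.
  have hpre : NullMeasurableSet (ε ⁻¹' G) μ := hε.aemeasurable.nullMeasurableSet_preimage hGm
  obtain ⟨E, hEsub, hEm, hEae⟩ := hpre.exists_measurable_subset_ae_eq
  refine ⟨E, hEm, ?_, ?_⟩
  · rw [measure_congr hEae]
    have h1 : μ (ε ⁻¹' G) = (Measure.pi fun _ : Fin n => gaussianReal 0 (Real.toNNReal (σ₀ ^ 2))) G :=
      hε.measure_eq (p := fun e => e ∈ G) hGm
    rw [h1]
    refine le_trans (ENNReal.ofReal_le_ofReal ?_) hGp
    linarith
  intro ω hω b hb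
  obtain ⟨hNσ, hnoise⟩ := hEsub hω
  rw [hY ω] at hb ⊢
  set e := ε ω
  have hN : 0 < nNorm e := hσpos.trans_le hNσ
  have hRN : √2 * (R * σl) ≤ √2 * (R * nNorm e) := by gcongr
  have hnoiseX : ∀ j, |(e ⬝ᵥ fun i => X i j) / n| ≤ √2 * (R * nNorm e) := fun j =>
    (hnoise (Sum.inl j)).trans hRN
  have hnoiseV := hproj e (√2 * (R * nNorm e)) (fun i => (hnoise (Sum.inr i)).trans hRN)
    (by positivity)
  have hη : 0 < 1 - η := by linarith
  have hl1' : R * l1Norm β₀ ≤ (1 - η) * (η ^ 2 / 8) * nNorm e := by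
    rw [div_le_iff₀ hσpos] at hl1
    refine hl1.trans ?_
    gcongr
    exact sqrt_one_add_sq_sub_one_le η
  obtain ⟨hlow, hup⟩ := hb.residual_bounds hη₀ hη₁ hRpos hlam hN hl1'
    (fun j => (hnoiseX j).trans_eq (by ring))
  have hs : 0 < nNorm (X *ᵥ β₀ + e - X *ᵥ b) := lt_of_lt_of_le (by positivity) hlow
  have hlam0 : 0 < lam₀ := by
    by_contra h
    nlinarith
  have hKlow : 2 * (R * nNorm e) ≤ lam₀ * nNorm (X *ᵥ β₀ + e - X *ᵥ b) := by
    calc 2 * (R * nNorm e) = lam₀ * ((1 - η) * nNorm e) := by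
          linear_combination -nNorm e * hlam
      _ ≤ _ := by gcongr
  -- η ≤ 1/3 gives λ₀ ≤ 3R and σ̂ ≤ (4/3)N, hence the upper limit 4K.
  have hlam3 : lam₀ ≤ 3 * R := by nlinarith
  have hKup : lam₀ * nNorm (X *ᵥ β₀ + e - X *ᵥ b) ≤ 4 * (R * nNorm e) := by
    calc _ ≤ (3 * R) * ((1 + η) * nNorm e) := by gcongr
      _ ≤ (3 * R) * ((1 + 1 / 3) * nNorm e) := by gcongr
      _ = _ := by ring
  have horacle := hb.oracle_inequality hX hlam0.le (by positivity) hs hKlow hKup hnoiseX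
  refine ⟨hN, hs, ?_, ?_, ?_, ?_⟩
  · have h1 : 0 ≤ l1Norm (b - β₀) := l1Norm_nonneg _
    rw [← mul_div_assoc, div_le_div_iff₀ hs hN]
    nlinarith
  · intro hφ
    have h1 := horacle (sStar X β₀ R σl) (Or.inr hnoiseV) hφ
    refine le_trans ?_ (weak_sparsity_bound hX hRpos hσpos hr₀ hr₁ hρ hlr hφ)
    have hm : 0 ≤ ∑ j ∈ (sStar X β₀ R σl)ᶜ, |β₀ j| := Finset.sum_nonneg fun _ _ => abs_nonneg _
    calc _ ≤ (37 * ∑ j ∈ (sStar X β₀ R σl)ᶜ, |β₀ j| + 108 * (R * nNorm e) *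
          ((sStar X β₀ R σl).card / compatSq X 6 (sStar X β₀ R σl))) / nNorm e := by gcongr
      _ = 37 * (∑ j ∈ (sStar X β₀ R σl)ᶜ, |β₀ j|) / nNorm e + 108 * R *
          ((sStar X β₀ R σl).card / compatSq X 6 (sStar X β₀ R σl)) := by
        field_simp
      _ ≤ _ := by gcongr
  · intro hφ
    have hm : ∑ j ∈ (activeSet β₀)ᶜ, |β₀ j| = 0 := by
      refine Finset.sum_eq_zero fun j hj => ?_
      simpa [activeSet] using hj
    have h1 := horacle (activeSet β₀) (Or.inl hm) hφ
    rw [hm, mul_zero, zero_add] at h1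
    rw [div_le_iff₀ hN]
    refine h1.trans_eq ?_
    ring
  · rw [Real.rpow_neg hw.le, ← Real.sqrt_eq_rpow, ← one_div, div_le_div_iff₀ hs (Real.sqrt_pos.2 hw)]
    calc (1 - η) * σ₀ * √(1 - 2 * √(L / n)) = (1 - η) * σl := by rw [hσeq]; ring
      _ ≤ (1 - η) * nNorm e := by gcongr
      _ ≤ 1 * nNorm (X *ᵥ β₀ + e - X *ᵥ b) := by rw [one_mul]; exact hlow
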